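/- Theorem 4.8 (type-definable field with no infinite descending chain). Let $T$ be a first-order theory which is NIP: there are no formula $\varphi(\bar x,\bar y)$ and model of $T$ containing tuples $(\bar a_i)_{i\in\omega}$ and $(\bar b_I)_{I\subseteq\omega}$ such that $\varphi(\bar a_i,\bar b_I)$ holds if and only if $i\in I$. Let $\kappa>\aleph_0$ be a strong limit cardinal greater than the number of symbols of the language, and let $M\models T$ be $\kappa$-saturated. Call a subset of some $M^n$ type-definable if it is the set of realizations in $M$ of a partial type over a set of fewer than $\kappa$ parameters from $M$, and call the index of a subgroup unbounded if it is at least $\kappa$. Let $K$ be an infinite type-definable field in $M$, that is, a field whose underlying set is a type-definable subset of some $M^n$ and whose addition and multiplication are definable with parameters (their graphs are the traces on $K^3$ of definable sets), and suppose that $K$ has characteristic $p>0$. Suppose that there is no infinite decreasing sequence $G_0\ge G_1\ge G_2\ge\cdots$ of type-definable subgroups of the additive group $(K,+)$ such that each $G_{i+1}$ has unbounded index in $G_i$. Then $K$ is Artin-Schreier closed: there is no field extension $L/K$ with $L=K(\alpha)$ for some $\alpha\in L\setminus K$ such that $\alpha^p-\alpha\in K$. -/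

import Mathlib

universe u v w

open FirstOrder Cardinal

namespace NIPField

/-- The theory `T` has the independence property: some formula `φ(x, y)` (in finite tuples `x`, `y`)
and some model of `T` containing tuples `a i` (`i ∈ ℕ`) and `b I` (`I ⊆ ℕ`) satisfy
`φ(a i, b I) ↔ i ∈ I`. By compactness, models in the universe of the language suffice, as in
Mathlib's definition of satisfiability. -/
def HasIndependenceProperty {L : FirstOrder.Language.{u, v}} (T : L.Theory) : Prop :=
  ∃ (m n : ℕ) (φ : L.Formula (Fin m ⊕ Fin n)) (N : FirstOrder.Language.Theory.ModelType.{u, v, max u v} T)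
    (a : ℕ → Fin m → N) (b : Set ℕ → Fin n → N),
    ∀ (i : ℕ) (I : Set ℕ), φ.Realize (Sum.elim (a i) (b I)) ↔ i ∈ I

/-- A theory is NIP if it does not have the independence property. -/
def IsNIP {L : FirstOrder.Language.{u, v}} (T : L.Theory) : Prop :=
  ¬ HasIndependenceProperty T

/-- `M` is `κ`-saturated: every partial type in finitely many variables, over fewer than `κ`
parameters, which is finitely satisfiable in `M` is realized in `M`. -/
def IsSaturated (L : FirstOrder.Language.{u, v}) (M : Type w) [L.Structure M] (κ : Cardinal.{w}) : Prop :=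
  ∀ A : Set M, #A < κ → ∀ (n : ℕ) (Φ : Set (L[[A]].Formula (Fin n))),
    (∀ Φ₀ : Finset (L[[A]].Formula (Fin n)), (Φ₀ : Set (L[[A]].Formula (Fin n))) ⊆ Φ →
      ∃ x : Fin n → M, ∀ φ ∈ Φ₀, φ.Realize x) →
    ∃ x : Fin n → M, ∀ φ ∈ Φ, φ.Realize x

/-- A set of finite tuples is type-definable if it is the set of realizations of a partial type over
a small parameter set, that is, an intersection of any family of sets definable over one and the
same set of fewer than `κ` parameters. -/
def IsTypeDefinable (L : FirstOrder.Language.{u, v}) {M : Type w} [L.Structure M] (κ : Cardinal.{w}) {n : ℕ}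
    (X : Set (Fin n → M)) : Prop :=
  ∃ A : Set M, #A < κ ∧
    ∃ S : Set (Set (Fin n → M)), (∀ D ∈ S, A.Definable L D) ∧ X = ⋂₀ S

/-- A binary operation on a set `X` of `n`-tuples is (relatively) definable: its graph is the trace on
`X × X × X` of a set of triples of `n`-tuples which is definable in `M` with parameters
(finitely many parameters, since a formula only involves finitely many). -/
def IsDefinableOperation (L : FirstOrder.Language.{u, v}) {M : Type w} [L.Structure M] {n : ℕ}
    (X : Set (Fin n → M)) (f : X → X → X) : Prop :=
  ∃ D : Set (Fin n ⊕ Fin n ⊕ Fin n → M), (Set.univ : Set M).Definable L D ∧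
    ∀ x y z : X,
      Sum.elim (x : Fin n → M) (Sum.elim (y : Fin n → M) (z : Fin n → M)) ∈ D ↔ f x y = z

/-- The field structure given on `X` makes it a type-definable field: `X` is type-definable, and
addition and multiplication are definable. -/
structure IsTypeDefinableField (L : FirstOrder.Language.{u, v}) {M : Type w} [L.Structure M]
    (κ : Cardinal.{w}) {n : ℕ} (X : Set (Fin n → M)) [Field X] : Prop where
  typeDefinable : IsTypeDefinable L κ X
  definable_add : IsDefinableOperation L X (fun x y => x + y)
  definable_mul : IsDefinableOperation L X (fun x y => x * y)

/-- For `H ≤ G`: the index of `H` in `G` is unbounded, that is, it is not smaller than `κ`. -/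
def HasUnboundedIndex {K : Type w} [AddGroup K] (κ : Cardinal.{w}) (H G : AddSubgroup K) : Prop :=
  κ ≤ #(G ⧸ H.addSubgroupOf G)

/-- An infinite decreasing sequence of type-definable subgroups of the additive group of `X`, each of
unbounded index in its predecessor. -/
def IsUnboundedChain (L : FirstOrder.Language.{u, v}) {M : Type w} [L.Structure M] (κ : Cardinal.{w}) {n : ℕ}
    (X : Set (Fin n → M)) [Field X] (G : ℕ → AddSubgroup X) : Prop :=
  (∀ i, IsTypeDefinable L κ ((fun x : X => (x : Fin n → M)) '' (G i : Set X))) ∧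
    ∀ i, G (i + 1) ≤ G i ∧ HasUnboundedIndex κ (G (i + 1)) (G i)

/-- An extension `E / K` of fields of characteristic `p` is an Artin-Schreier extension if `E = K(α)`
for some `α ∈ E \ K` with `α ^ p - α ∈ K`. -/
def IsArtinSchreierExtension (p : ℕ) (K E : Type*) [Field K] [Field E] [Algebra K E] : Prop :=
  ∃ α : E, α ∉ Set.range (algebraMap K E) ∧ α ^ p - α ∈ Set.range (algebraMap K E) ∧
    IntermediateField.adjoin K {α} = ⊤

/-- A field `K` of characteristic `p` is Artin-Schreier closed if it has no Artin-Schreier extension.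
(Every algebraic extension of `K` has an isomorphic copy in the universe of `K`.) -/
def IsArtinSchreierClosed (p : ℕ) (K : Type w) [Field K] : Prop :=
  ∀ (E : Type w) [Field E] [Algebra K E], ¬ IsArtinSchreierExtension p K E

end NIPField

/-! The main point is connectedness: a type-definable additive subgroup `H` of `K` of index below
`κ` is all of `K`. Scaling reduces this to `1 ∈ H`. Otherwise pigeonhole on cosets yields
arbitrarily many `c i`, `d i` with `d i ∈ c j • H` for `i ≠ j` and `d i ∈ c i • (1 + H)`. Sums of
the `d i` then make a definable set separating `y ∈ x • H` from `y ∈ x • (1 + H)` shatter sets of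
every finite size, against NIP (`exists_independent_translates`, `one_mem_of_mk_quotient_lt`).

Hence a proper type-definable subgroup has unbounded index, and the chain condition applies. The
groups `K ^ (p ^ i)` show that `K` is perfect. If `℘(x) = x ^ p - x` were not onto, intersecting
suitable groups `a • ℘(K)` would give an infinite chain: each partial intersection contains the
values of a nonzero additive polynomial, which over a perfect field is congruent to some `r * x`
with `r ≠ 0` modulo `a • ℘(K)` for a suitable `a ≠ 0`, so intersecting with `a • ℘(K)` costs
unbounded index. Finally, two roots of `X ^ p - X - c` differ by an element of the prime field. -/

namespace NIPField

/-! ### Compactness for the independence property -/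

open FirstOrder.Language

/-- By compactness, the independence property follows from its finite instances in a single model. -/
theorem hasIndependenceProperty_of_fin {L : FirstOrder.Language.{u, v}} {T : L.Theory}
    {M : Type w} [L.Structure M] [Nonempty M] (hM : M ⊨ T) {m n : ℕ}
    (φ : L.Formula (Fin m ⊕ Fin n))
    (h : ∀ N : ℕ, ∃ (a : Fin N → Fin m → M) (b : Set (Fin N) → Fin n → M),
      ∀ i I, φ.Realize (Sum.elim (a i) (b I)) ↔ i ∈ I) :
    HasIndependenceProperty T := by
  classical
  let C : Type := (ℕ × Fin m) ⊕ (Set ℕ × Fin n)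
  let ψ : ℕ → Set ℕ → L.Formula C := fun i I =>
    φ.relabel (Sum.elim (fun k => Sum.inl (i, k)) (fun k => Sum.inr (I, k)))
  let S : ℕ → L[[C]].Theory := fun N => (L.lhomWithConstants C).onTheory T ∪
    {s | ∃ i < N, ∃ I : Set ℕ, s = Formula.equivSentence (if i ∈ I then ψ i I else (ψ i I).not)}
  have hS : Theory.IsSatisfiable (⋃ N, S N) := by
    refine (Theory.isSatisfiable_directed_union_iff (Monotone.directed_le ?_)).2 ?_
    · intro N N' hN
      refine Set.union_subset_union_right _ ?_
      rintro s ⟨i, hi, I, rfl⟩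
      exact ⟨i, hi.trans_le hN, I, rfl⟩
    · intro N
      obtain ⟨a, b, hab⟩ := h N
      -- `S N` only constrains indices below `N`: the constants for later `i` are arbitrary, and `I`
      -- is interpreted through its trace on `Fin N`.
      let c : C → M := Sum.elim
        (fun x => if hx : x.1 < N then a ⟨x.1, hx⟩ x.2 else Classical.arbitrary M)
        (fun x => b {j | (j : ℕ) ∈ x.1} x.2)
      let _ := constantsOn.structure c
      have : M ⊨ S N := by
        refine ((LHom.onTheory_model _ _).2 hM).union ?_
        refine ⟨?_⟩
        rintro s ⟨i, hi, I, rfl⟩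
        have key : (ψ i I).Realize c ↔ i ∈ I := by
          have := hab ⟨i, hi⟩ {j | (j : ℕ) ∈ I}
          rw [Set.mem_ofPred_eq] at this
          rw [← this, Formula.realize_relabel]
          refine iff_of_eq (congrArg _ ?_)
          ext x
          rcases x with k | k <;> simp [c, hi]
        refine (Formula.realize_equivSentence M _).2 ?_
        change Formula.Realize _ c
        split_ifs with hI
        · exact key.2 hI
        · rw [Formula.realize_not, key]
          exact hI
      exact Theory.Model.isSatisfiable M
  obtain ⟨N⟩ := hS
  have hN : ∀ i (I : Set ℕ), (N : Type _) ⊨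
      Formula.equivSentence (if i ∈ I then ψ i I else (ψ i I).not) := fun i I =>
    Theory.realize_sentence_of_mem (⋃ N, S N)
      (Set.mem_iUnion.2 ⟨i + 1, Or.inr ⟨i, i.lt_succ_self, I, rfl⟩⟩)
  let N' := Theory.ModelType.reduct (L.lhomWithConstants C)
    (N.subtheoryModel ((Set.subset_union_left (s := (L.lhomWithConstants C).onTheory T)).trans
      (Set.subset_iUnion S 0)))
  refine ⟨m, n, φ, N', fun i k => (L.con (Sum.inl (i, k) : C) : N),
    fun I k => (L.con (Sum.inr (I, k) : C) : N), fun i I => ?_⟩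
  let _ : L.Structure N := (L.lhomWithConstants C).reduct N
  have : (L.lhomWithConstants C).IsExpansionOn N := LHom.isExpansionOn_reduct _ _
  have key : (ψ i I).Realize (fun x => (L.con x : N)) ↔ φ.Realize (Sum.elim
      (fun k => (L.con (Sum.inl (i, k) : C) : N)) (fun k => (L.con (Sum.inr (I, k) : C) : N))) := by
    rw [Formula.realize_relabel]
    refine iff_of_eq (congrArg _ ?_)
    ext x
    rcases x with k | k <;> rfl
  refine key.symm.trans ?_
  have h1 := (Formula.realize_equivSentence (N : Type _) _).1 (hN i I)
  split_ifs at h1 with hI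
  · exact iff_of_true h1 hI
  · exact iff_of_false (Formula.realize_not.1 h1) hI

/-- A set definable with parameters in a model of an NIP theory cannot shatter arbitrarily large
finite sets. -/
theorem hasIndependenceProperty_of_definable {L : FirstOrder.Language.{u, v}} {T : L.Theory}
    {M : Type w} [L.Structure M] [Nonempty M] (hM : M ⊨ T) {α β : Type*} [Finite α] [Finite β]
    {A : Set M} {D : Set (α ⊕ β → M)} (hD : A.Definable L D)
    (h : ∀ N : ℕ, ∃ (a : Fin N → α → M) (b : Set (Fin N) → β → M),
      ∀ i I, Sum.elim (a i) (b I) ∈ D ↔ i ∈ I) :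
    HasIndependenceProperty T := by
  obtain ⟨A₀, -, hD⟩ := Set.definable_iff_finitely_definable.1 hD
  obtain ⟨φ, rfl⟩ := Set.definable_iff_exists_formula_sum.1 hD
  obtain ⟨m, ⟨e⟩⟩ := Finite.exists_equiv_fin α
  -- The finitely many parameters are appended to the second tuple, which leaves a formula without
  -- parameters.
  obtain ⟨n, ⟨f⟩⟩ := Finite.exists_equiv_fin (β ⊕ (A₀ : Set M))
  refine hasIndependenceProperty_of_fin hM (m := m) (n := n) (φ.relabel (Sum.elim
    (fun x => Sum.inr (f (Sum.inr x)))
    (Sum.elim (fun x => Sum.inl (e x)) (fun x => Sum.inr (f (Sum.inl x)))))) fun N => ?_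
  obtain ⟨a, b, hab⟩ := h N
  refine ⟨fun i => a i ∘ e.symm, fun I => Sum.elim (b I) (fun x : (A₀ : Set M) => (x : M)) ∘ f.symm,
    fun i I => ?_⟩
  rw [← hab i I, Formula.realize_relabel, Set.mem_ofPred_eq]
  refine iff_of_eq (congrArg _ ?_)
  ext x
  rcases x with x | x | x <;> simp

/-! ### Type-definable sets and saturation -/

section TypeDefinable

variable {L : FirstOrder.Language.{u, v}} {M : Type w} [L.Structure M] {α β : Type*}

theorem definable_sInter_finset {A : Set M} (S : Finset (Set (α → M)))
    (hS : ∀ D ∈ S, A.Definable L D) : A.Definable L (⋂₀ (S : Set (Set (α → M)))) := by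
  classical
  induction S using Finset.induction with
  | empty => simp
  | insert D S _ ih =>
    rw [Finset.coe_insert, Set.sInter_insert]
    exact (hS D (Finset.mem_insert_self D S)).inter
      (ih fun E hE => hS E (Finset.mem_insert_of_mem hE))

theorem definable_slice {A : Set M} {D : Set (α ⊕ β → M)} (hD : A.Definable L D) (v : α → M) :
    (A ∪ Set.range v).Definable L {u : β → M | Sum.elim v u ∈ D} := by
  obtain ⟨φ, rfl⟩ := Set.definable_iff_exists_formula_sum.1 hD
  refine Set.definable_iff_exists_formula_sum.2 ⟨φ.relabel (Sum.elim
    (fun x : A => Sum.inl ⟨x, Or.inl x.2⟩)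
    (Sum.elim (fun x => Sum.inl ⟨v x, Or.inr ⟨x, rfl⟩⟩) Sum.inr)), ?_⟩
  ext u
  rw [Set.mem_ofPred_eq, Set.mem_ofPred_eq, Set.mem_ofPred_eq, Formula.realize_relabel]
  refine iff_of_eq (congrArg _ ?_)
  ext x
  rcases x with x | x | x <;> rfl

theorem definable_singleton [Finite α] (v : α → M) : (Set.range v).Definable L {v} := by
  have : ({v} : Set (α → M)) = ⋂ i, {u | u i = v i} := by
    ext u
    simp [funext_iff]
  rw [this]
  refine Set.definable_iInter_of_finite fun i => ?_
  exact (Set.Definable.singleton_of_mem L (Set.mem_range_self i)).preimage_comp fun _ => i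

variable (L) in
/-- An intersection of sets definable over `A`. -/
def TypeDefinableOver (A : Set M) (X : Set (α → M)) : Prop :=
  ∃ S : Set (Set (α → M)), (∀ D ∈ S, A.Definable L D) ∧ X = ⋂₀ S

namespace TypeDefinableOver

variable {A B : Set M} {X Y : Set (α → M)}

theorem mono (hX : TypeDefinableOver L A X) (h : A ⊆ B) : TypeDefinableOver L B X := by
  obtain ⟨S, hS, rfl⟩ := hX
  exact ⟨S, fun D hD => (hS D hD).mono h, rfl⟩

theorem of_definable (hX : A.Definable L X) : TypeDefinableOver L A X :=
  ⟨{X}, by simpa using hX, by simp⟩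

theorem inter (hX : TypeDefinableOver L A X) (hY : TypeDefinableOver L A Y) :
    TypeDefinableOver L A (X ∩ Y) := by
  obtain ⟨S, hS, rfl⟩ := hX
  obtain ⟨S', hS', rfl⟩ := hY
  refine ⟨S ∪ S', ?_, Set.sInter_union S S' |>.symm⟩
  rintro D (hD | hD)
  exacts [hS D hD, hS' D hD]

theorem preimage_comp (hX : TypeDefinableOver L A X) (f : α → β) :
    TypeDefinableOver L A ((fun g : β → M => g ∘ f) ⁻¹' X) := by
  obtain ⟨S, hS, rfl⟩ := hX
  refine ⟨(fun D => (fun g : β → M => g ∘ f) ⁻¹' D) '' S, ?_, ?_⟩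
  · rintro _ ⟨D, hD, rfl⟩
    exact (hS D hD).preimage_comp f
  · ext g
    simp

end TypeDefinableOver

variable {κ : Cardinal.{w}}

theorem IsSaturated.nonempty_sInter (hsat : IsSaturated L M κ) {A : Set M} (hA : #A < κ)
    [Finite α] {S : Set (Set (α → M))} (hS : ∀ D ∈ S, A.Definable L D)
    (h : ∀ S₀ : Finset (Set (α → M)), (S₀ : Set (Set (α → M))) ⊆ S →
      (⋂₀ (S₀ : Set (Set (α → M)))).Nonempty) : (⋂₀ S).Nonempty := by
  classical
  obtain ⟨n, ⟨e⟩⟩ := Finite.exists_equiv_fin α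
  obtain ⟨x, hx⟩ := hsat A hA n
    {φ | ∃ D ∈ S, ∀ x : Fin n → M, φ.Realize x ↔ x ∘ e ∈ D} fun Φ hΦ => by
      choose! D hDS hD using hΦ
      obtain ⟨x, hx⟩ := h (Φ.image D) (by
        intro E hE
        obtain ⟨φ, hφ, rfl⟩ := Finset.mem_image.1 hE
        exact hDS hφ)
      refine ⟨x ∘ e.symm, fun φ hφ => (hD hφ _).2 ?_⟩
      have := hx (@D φ) (Finset.mem_image.2 ⟨φ, hφ, rfl⟩)
      rwa [Function.comp_assoc, Equiv.symm_comp_self, Function.comp_id]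
  refine ⟨x ∘ e, fun D hD => ?_⟩
  obtain ⟨φ, hφ⟩ := (hS D hD).preimage_comp e
  have hφ' : ∀ y : Fin n → M, φ.Realize y ↔ y ∘ e ∈ D := fun y => by
    have : y ∈ (fun g : Fin n → M => g ∘ e) ⁻¹' D ↔ φ.Realize y := by
      rw [hφ, Set.mem_ofPred_eq]
    exact this.symm
  exact (hφ' x).1 (hx φ ⟨D, hD, hφ'⟩)

/-- By saturation, a fibre is nonempty once all its finite approximations are; so the projection is
the intersection of the projections of finite subintersections. -/
theorem TypeDefinableOver.exists_of_finite (hsat : IsSaturated L M κ) (hκ : ℵ₀ < κ)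
    [Finite α] [Finite β] {A : Set M} (hA : #A < κ) {X : Set (α ⊕ β → M)}
    (hX : TypeDefinableOver L A X) :
    TypeDefinableOver L A {v : α → M | ∃ u : β → M, Sum.elim v u ∈ X} := by
  classical
  obtain ⟨S, hS, rfl⟩ := hX
  refine ⟨{E | ∃ S₀ : Finset (Set (α ⊕ β → M)), (S₀ : Set _) ⊆ S ∧
    E = {v : α → M | ∃ u : β → M, Sum.elim v u ∈ ⋂₀ (S₀ : Set (Set (α ⊕ β → M)))}}, ?_, ?_⟩
  · rintro _ ⟨S₀, hS₀, rfl⟩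
    exact (definable_sInter_finset S₀ fun D hD => hS D (hS₀ hD)).exists_of_finite
  · refine Set.Subset.antisymm ?_ ?_
    · rintro v ⟨u, hu⟩ _ ⟨S₀, hS₀, rfl⟩
      exact ⟨u, Set.sInter_subset_sInter hS₀ hu⟩
    · intro v hv
      have hA' : #(A ∪ Set.range v : Set M) < κ :=
        (mk_union_le _ _).trans_lt (add_lt_of_lt hκ.le hA
          ((lt_aleph0_of_finite (Set.range v)).trans hκ))
      obtain ⟨u, hu⟩ := hsat.nonempty_sInter hA'
        (S := (fun D => {u : β → M | Sum.elim v u ∈ D}) '' S)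
        (by
          rintro _ ⟨D, hD, rfl⟩
          exact definable_slice (hS D hD) v)
        (by
          intro S₁ hS₁
          obtain ⟨S₀, hS₀, rfl⟩ := Finset.subset_set_image_iff.1 hS₁
          obtain ⟨u, hu⟩ := hv _ ⟨S₀, hS₀, rfl⟩
          refine ⟨u, ?_⟩
          intro E hE
          obtain ⟨D, hD, rfl⟩ := Finset.mem_image.1 (Finset.mem_coe.1 hE)
          exact hu D hD)
      exact ⟨u, fun D hD => hu _ ⟨D, hD, rfl⟩⟩

theorem TypeDefinableOver.exists_separating (hsat : IsSaturated L M κ) [Finite α] {A : Set M}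
    (hA : #A < κ) {X Y : Set (α → M)} (hX : TypeDefinableOver L A X)
    (hY : TypeDefinableOver L A Y) (hXY : Disjoint X Y) :
    ∃ D : Set (α → M), A.Definable L D ∧ X ⊆ D ∧ Disjoint D Y := by
  classical
  obtain ⟨S, hS, rfl⟩ := hX
  obtain ⟨S', hS', rfl⟩ := hY
  have : ¬ (⋂₀ (S ∪ S')).Nonempty := by
    rwa [Set.sInter_union, Set.not_nonempty_iff_eq_empty, ← Set.disjoint_iff_inter_eq_empty]
  have := mt (hsat.nonempty_sInter hA (S := S ∪ S') (by
    rintro D (hD | hD)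
    exacts [hS D hD, hS' D hD])) this
  push Not at this
  obtain ⟨S₀, hS₀, h⟩ := this
  refine ⟨⋂₀ (S₀.filter (· ∈ S) : Finset _), definable_sInter_finset _ fun D hD =>
    hS D (Finset.mem_filter.1 hD).2, Set.sInter_subset_sInter fun D hD =>
    (Finset.mem_filter.1 hD).2, Set.disjoint_left.2 fun x hx hx' => ?_⟩
  have : x ∈ ⋂₀ (S₀ : Set (Set (α → M))) := fun D hD => by
    by_cases hDS : D ∈ S
    · exact hx D (Finset.mem_filter.2 ⟨hD, hDS⟩)
    · exact hx' D ((hS₀ hD).resolve_left hDS)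
  rw [h] at this
  exact this

variable (L κ) in
/-- Type-definability over fewer than `κ` parameters, for tuples indexed by an arbitrary type. -/
def SmallTypeDefinable (X : Set (α → M)) : Prop :=
  ∃ A : Set M, #A < κ ∧ TypeDefinableOver L A X

theorem isTypeDefinable_iff {n : ℕ} {X : Set (Fin n → M)} :
    IsTypeDefinable L κ X ↔ SmallTypeDefinable L κ X := Iff.rfl

namespace SmallTypeDefinable

variable {X Y : Set (α → M)}

theorem exists_common (hκ : ℵ₀ < κ) {X : Set (α → M)} {Y : Set (β → M)}
    (hX : SmallTypeDefinable L κ X) (hY : SmallTypeDefinable L κ Y) :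
    ∃ A : Set M, #A < κ ∧ TypeDefinableOver L A X ∧ TypeDefinableOver L A Y := by
  obtain ⟨A, hA, hX⟩ := hX
  obtain ⟨B, hB, hY⟩ := hY
  exact ⟨A ∪ B, (mk_union_le _ _).trans_lt (add_lt_of_lt hκ.le hA hB),
    hX.mono Set.subset_union_left, hY.mono Set.subset_union_right⟩

theorem of_definable (hκ : ℵ₀ < κ) {A : Set M} (hX : A.Definable L X) :
    SmallTypeDefinable L κ X := by
  obtain ⟨A₀, -, hX⟩ := Set.definable_iff_finitely_definable.1 hX
  exact ⟨A₀, (lt_aleph0_of_finite _).trans hκ, .of_definable hX⟩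

theorem inter (hκ : ℵ₀ < κ) (hX : SmallTypeDefinable L κ X) (hY : SmallTypeDefinable L κ Y) :
    SmallTypeDefinable L κ (X ∩ Y) := by
  obtain ⟨A, hA, hX, hY⟩ := exists_common hκ hX hY
  exact ⟨A, hA, hX.inter hY⟩

theorem iInter_of_finite {ι : Type*} [Finite ι] (hκ : ℵ₀ < κ) {X : ι → Set (α → M)}
    (hX : ∀ i, SmallTypeDefinable L κ (X i)) : SmallTypeDefinable L κ (⋂ i, X i) := by
  classical
  have := Fintype.ofFinite ι
  have : ∀ s : Finset ι, SmallTypeDefinable L κ (⋂ i ∈ s, X i) := fun s => by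
    induction s using Finset.induction with
    | empty => simpa using of_definable hκ (Set.definable_univ (A := ∅))
    | insert i s _ ih =>
      rw [Finset.set_biInter_insert]
      exact (hX i).inter hκ ih
  simpa using this Finset.univ

theorem preimage_comp (hX : SmallTypeDefinable L κ X) (f : α → β) :
    SmallTypeDefinable L κ ((fun g : β → M => g ∘ f) ⁻¹' X) := by
  obtain ⟨A, hA, hX⟩ := hX
  exact ⟨A, hA, hX.preimage_comp f⟩

theorem exists_of_finite (hsat : IsSaturated L M κ) (hκ : ℵ₀ < κ) [Finite α] [Finite β]
    {X : Set (α ⊕ β → M)} (hX : SmallTypeDefinable L κ X) :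
    SmallTypeDefinable L κ {v : α → M | ∃ u : β → M, Sum.elim v u ∈ X} := by
  obtain ⟨A, hA, hX⟩ := hX
  exact ⟨A, hA, hX.exists_of_finite hsat hκ hA⟩

theorem exists_separating (hsat : IsSaturated L M κ) (hκ : ℵ₀ < κ) [Finite α]
    (hX : SmallTypeDefinable L κ X) (hY : SmallTypeDefinable L κ Y) (hXY : Disjoint X Y) :
    ∃ (A : Set M) (D : Set (α → M)), A.Definable L D ∧ X ⊆ D ∧ Disjoint D Y := by
  obtain ⟨A, hA, hX, hY⟩ := exists_common hκ hX hY
  exact ⟨A, hX.exists_separating hsat hA hY hXY⟩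

/-- In a saturated structure, infinite type-definable sets are large. -/
theorem le_mk_of_infinite (hsat : IsSaturated L M κ) (hκ : ℵ₀ < κ) {n : ℕ}
    {X : Set (Fin n → M)} (hX : SmallTypeDefinable L κ X) (hinf : X.Infinite) : κ ≤ #X := by
  classical
  by_contra! hlt
  obtain ⟨A, hA, S, hS, rfl⟩ := hX
  -- If the set were small, its points could all serve as parameters, and the type of a further
  -- point in it would be finitely satisfiable, hence realized.
  let B : Set M := ⋃ x : ↥(⋂₀ S), Set.range (x : Fin n → M)
  have hB : #B < κ := by
    refine (mk_iUnion_le _).trans_lt ((mul_le_mul_right (ciSup_le' fun x =>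
      (lt_aleph0_of_finite _).le) _).trans_lt (mul_lt_of_lt hκ.le hlt hκ))
  have hAB : #(A ∪ B : Set M) < κ := (mk_union_le _ _).trans_lt (add_lt_of_lt hκ.le hA hB)
  obtain ⟨y, hy⟩ := hsat.nonempty_sInter hAB (S := S ∪ (fun x => {x}ᶜ) '' ⋂₀ S)
    (by
      rintro D (hD | ⟨x, hx, rfl⟩)
      · exact (hS D hD).mono Set.subset_union_left
      · exact ((definable_singleton x).mono ((Set.subset_iUnion
          (fun x : ↥(⋂₀ S) => Set.range (x : Fin n → M)) ⟨x, hx⟩).trans Set.subset_union_right)).compl)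
    (by
      intro S₀ hS₀
      have hfin : {x | ({x}ᶜ : Set (Fin n → M)) ∈ S₀}.Finite :=
        S₀.finite_toSet.preimage (f := fun x => ({x}ᶜ : Set (Fin n → M)))
          fun x _ y _ h => by simpa using h
      obtain ⟨y, hy, hy'⟩ := (hinf.sdiff hfin).nonempty
      refine ⟨y, fun D hD => ?_⟩
      rcases hS₀ hD with hDS | ⟨x, hx, rfl⟩
      · exact hy D hDS
      · rintro rfl
        exact hy' hD)
  exact hy _ (Or.inr ⟨y, fun D hD => hy D (Or.inl hD), rfl⟩) rfl

end SmallTypeDefinable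

end TypeDefinable

/-- A type-definable field in a saturated structure. -/
structure IsSaturatedField (L : FirstOrder.Language.{u, v}) {M : Type w} [L.Structure M]
    (κ : Cardinal.{w}) {n : ℕ} (K : Set (Fin n → M)) [Field K] : Prop where
  isSaturated : IsSaturated L M κ
  aleph0_lt : ℵ₀ < κ
  isTypeDefinableField : IsTypeDefinableField L κ K

/-! ### Type-definable relations and functions on the field -/

section Relations

variable {L : FirstOrder.Language.{u, v}} {M : Type w} [L.Structure M] {κ : Cardinal.{w}} {n : ℕ}
  {K : Set (Fin n → M)} {I J : Type*}

/-- The tuple of all coordinates of a tuple of elements of `K`. -/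
def coords (v : I → K) : I × Fin n → M := fun q => (v q.1 : Fin n → M) q.2

theorem coords_injective : Function.Injective (coords : (I → K) → I × Fin n → M) :=
  fun _ _ h => funext fun i => Subtype.ext (funext fun j => congrFun h (i, j))

variable (L κ) in
/-- A type-definable relation on `K`. -/
def TypeDefinableRel (R : Set (I → K)) : Prop :=
  SmallTypeDefinable L κ (coords '' R)

variable (L κ) in
/-- A function on tuples of elements of `K` with type-definable graph. -/
def TypeDefinableFun (f : (I → K) → K) : Prop :=
  TypeDefinableRel L κ {v : Option I → K | f (v ∘ some) = v none}

theorem TypeDefinableRel.isTypeDefinable {H : Set K} (h : TypeDefinableRel L κ {v : Unit → K | v () ∈ H}) :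
    IsTypeDefinable L κ ((↑) '' H : Set (Fin n → M)) := by
  rw [isTypeDefinable_iff]
  convert SmallTypeDefinable.preimage_comp h (fun q : Unit × Fin n => q.2) using 1
  ext w
  constructor
  · rintro ⟨x, hx, rfl⟩
    exact ⟨fun _ => x, hx, rfl⟩
  · rintro ⟨v, hv, h⟩
    exact ⟨v (), hv, funext fun k => congrFun h ((), k)⟩

variable [Field K]

namespace TypeDefinableRel

variable {R R' : Set (I → K)}

theorem univ [Finite I] (hK : IsSaturatedField L κ K) :
    TypeDefinableRel L κ (Set.univ : Set (I → K)) := by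
  have : coords '' (Set.univ : Set (I → K)) =
      ⋂ i : I, (fun w : I × Fin n → M => w ∘ fun j => (i, j)) ⁻¹' K := by
    ext w
    simp only [Set.image_univ, Set.mem_range, Set.mem_iInter, Set.mem_preimage]
    exact ⟨by rintro ⟨v, rfl⟩ i; exact (v i).2, fun h => ⟨fun i => ⟨_, h i⟩, rfl⟩⟩
  rw [TypeDefinableRel, this]
  exact .iInter_of_finite hK.aleph0_lt fun i =>
    SmallTypeDefinable.preimage_comp hK.isTypeDefinableField.typeDefinable _

theorem trace [Finite I] (hK : IsSaturatedField L κ K) {X : Set (I × Fin n → M)}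
    (hX : SmallTypeDefinable L κ X) : TypeDefinableRel L κ {v : I → K | coords v ∈ X} := by
  have : coords '' {v : I → K | coords v ∈ X} = coords '' (Set.univ : Set (I → K)) ∩ X := by
    ext w
    constructor
    · rintro ⟨v, hv, rfl⟩
      exact ⟨⟨v, trivial, rfl⟩, hv⟩
    · rintro ⟨⟨v, -, rfl⟩, hv⟩
      exact ⟨v, hv, rfl⟩
  rw [TypeDefinableRel, this]
  exact (univ hK).inter hK.aleph0_lt hX

theorem inter (hK : IsSaturatedField L κ K) (hR : TypeDefinableRel L κ R)
    (hR' : TypeDefinableRel L κ R') : TypeDefinableRel L κ (R ∩ R') := by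
  rw [TypeDefinableRel, Set.image_inter coords_injective]
  exact SmallTypeDefinable.inter hK.aleph0_lt hR hR'

theorem preimage_comp [Finite J] (hK : IsSaturatedField L κ K) (hR : TypeDefinableRel L κ R)
    (f : I → J) : TypeDefinableRel L κ {v : J → K | v ∘ f ∈ R} := by
  convert trace hK (SmallTypeDefinable.preimage_comp hR
    (fun q : I × Fin n => (f q.1, q.2))) using 1
  ext v
  exact (coords_injective.mem_set_image (s := R) (a := v ∘ f)).symm

theorem iInter_of_finite {ι : Type*} [Finite ι] [Finite I] (hK : IsSaturatedField L κ K)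
    {R : ι → Set (I → K)} (hR : ∀ i, TypeDefinableRel L κ (R i)) :
    TypeDefinableRel L κ (⋂ i, R i) := by
  convert trace hK (SmallTypeDefinable.iInter_of_finite hK.aleph0_lt hR) using 1
  ext v
  simp [coords_injective.mem_set_image]

theorem exists_of_finite [Finite I] [Finite J] (hK : IsSaturatedField L κ K)
    {R : Set (I ⊕ J → K)} (hR : TypeDefinableRel L κ R) :
    TypeDefinableRel L κ {v : I → K | ∃ y : J → K, Sum.elim v y ∈ R} := by
  have h := (SmallTypeDefinable.preimage_comp hR
    (Equiv.sumProdDistrib I J (Fin n))).exists_of_finite hK.isSaturated hK.aleph0_lt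
  rw [TypeDefinableRel]
  convert h using 1
  ext w
  constructor
  · rintro ⟨v, ⟨y, hy⟩, rfl⟩
    refine ⟨coords y, _, hy, ?_⟩
    ext ⟨i | j, k⟩ <;> rfl
  · rintro ⟨u, v, hv, h⟩
    refine ⟨v ∘ Sum.inl, ⟨v ∘ Sum.inr, by rwa [Sum.elim_comp_inl_inr]⟩, ?_⟩
    ext ⟨i, k⟩
    exact congrFun h (Sum.inl i, k)

/-- The values `f j v` are quantified out existentially, so this rests on closure under projection.
-/
theorem comp [Finite I] [Finite J] (hK : IsSaturatedField L κ K) {R : Set (J → K)}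
    (hR : TypeDefinableRel L κ R) {f : J → (I → K) → K} (hf : ∀ j, TypeDefinableFun L κ (f j)) :
    TypeDefinableRel L κ {v : I → K | (fun j => f j v) ∈ R} := by
  have h := exists_of_finite hK ((iInter_of_finite hK fun j => (hf j).preimage_comp hK
    (fun o : Option I => o.elim (Sum.inr j) Sum.inl)).inter hK (hR.preimage_comp hK Sum.inr))
  convert h using 1
  ext v
  constructor
  · intro hv
    exact ⟨fun j => f j v, Set.mem_iInter.2 fun j => rfl, hv⟩
  · rintro ⟨y, hy, hy'⟩
    have : (fun j => f j v) = y := funext fun j => Set.mem_iInter.1 hy j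
    rw [Set.mem_ofPred_eq, this]
    exact hy'

theorem of_isTypeDefinable [Finite I] (hK : IsSaturatedField L κ K) {H : Set K}
    (hH : IsTypeDefinable L κ ((↑) '' H : Set (Fin n → M))) (i : I) :
    TypeDefinableRel L κ {v : I → K | v i ∈ H} := by
  convert trace hK (SmallTypeDefinable.preimage_comp hH fun k => (i, k)) using 1
  ext v
  exact (Subtype.val_injective.mem_set_image (s := H) (a := v i)).symm

theorem apply_eq_apply [Finite I] (hK : IsSaturatedField L κ K) (i j : I) :
    TypeDefinableRel L κ {v : I → K | v i = v j} := by
  have hD : (∅ : Set M).Definable L {w : I × Fin n → M | ∀ k, w (i, k) = w (j, k)} := by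
    rw [show {w : I × Fin n → M | ∀ k, w (i, k) = w (j, k)} =
      ⋂ k, {w : I × Fin n → M | w (i, k) = w (j, k)} by ext; simp]
    exact Set.definable_iInter_of_finite fun k =>
      ⟨(Term.var (i, k)).equal (Term.var (j, k)), by ext; simp⟩
  convert trace hK (.of_definable hK.aleph0_lt hD) using 1
  ext v
  exact ⟨fun h k => by simp only [coords]; rw [h], fun h => Subtype.ext (funext h)⟩

end TypeDefinableRel

theorem typeDefinableFun_apply [Finite I] (hK : IsSaturatedField L κ K) (i : I) :
    TypeDefinableFun L κ (fun v : I → K => v i) :=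
  .apply_eq_apply hK (some i) none

theorem typeDefinableFun_const [Finite I] (hK : IsSaturatedField L κ K) (c : K) :
    TypeDefinableFun L κ (fun _ : I → K => c) := by
  have h := TypeDefinableRel.of_isTypeDefinable (I := Option I) hK (H := {c})
    (by rw [Set.image_singleton]; exact SmallTypeDefinable.of_definable hK.aleph0_lt (definable_singleton _)) none
  rw [TypeDefinableFun]
  convert h using 1
  ext v
  exact eq_comm

namespace TypeDefinableFun

variable {f g : (I → K) → K}

theorem precomp [Finite J] (hK : IsSaturatedField L κ K) (hf : TypeDefinableFun L κ f)
    (σ : I → J) : TypeDefinableFun L κ (fun v : J → K => f (v ∘ σ)) :=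
  TypeDefinableRel.preimage_comp hK hf (Option.map σ)

theorem binary [Finite I] (hK : IsSaturatedField L κ K) {op : K → K → K}
    (hop : IsDefinableOperation L K op) (hf : TypeDefinableFun L κ f)
    (hg : TypeDefinableFun L κ g) : TypeDefinableFun L κ (fun v => op (f v) (g v)) := by
  obtain ⟨D, hD, hop⟩ := hop
  have hgraph : TypeDefinableRel L κ {u : Fin 3 → K | op (u 0) (u 1) = u 2} := by
    convert TypeDefinableRel.trace hK (.of_definable hK.aleph0_lt (hD.preimage_comp
      (Sum.elim (fun k : Fin n => ((0 : Fin 3), k))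
        (Sum.elim (fun k => ((1 : Fin 3), k)) (fun k => ((2 : Fin 3), k)))))) using 1
    ext u
    refine (hop (u 0) (u 1) (u 2)).symm.trans (iff_of_eq (congrArg (· ∈ D) ?_))
    ext x
    rcases x with k | k | k <;> rfl
  refine hgraph.comp hK (f := ![fun v => f (v ∘ some), fun v => g (v ∘ some), fun v => v none]) ?_
  intro j
  fin_cases j
  · exact hf.precomp hK some
  · exact hg.precomp hK some
  · exact typeDefinableFun_apply hK none

theorem add [Finite I] (hK : IsSaturatedField L κ K) (hf : TypeDefinableFun L κ f)
    (hg : TypeDefinableFun L κ g) : TypeDefinableFun L κ (fun v => f v + g v) :=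
  hf.binary hK hK.isTypeDefinableField.definable_add hg

theorem mul [Finite I] (hK : IsSaturatedField L κ K) (hf : TypeDefinableFun L κ f)
    (hg : TypeDefinableFun L κ g) : TypeDefinableFun L κ (fun v => f v * g v) :=
  hf.binary hK hK.isTypeDefinableField.definable_mul hg

theorem sub [Finite I] (hK : IsSaturatedField L κ K) (hf : TypeDefinableFun L κ f)
    (hg : TypeDefinableFun L κ g) : TypeDefinableFun L κ (fun v => f v - g v) := by
  simpa [sub_eq_add_neg] using hf.add hK ((typeDefinableFun_const hK (-1)).mul hK hg)

theorem pow [Finite I] (hK : IsSaturatedField L κ K) (hf : TypeDefinableFun L κ f) (k : ℕ) :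
    TypeDefinableFun L κ (fun v => f v ^ k) := by
  induction k with
  | zero => simpa using typeDefinableFun_const hK 1
  | succ k ih => simpa [pow_succ] using ih.mul hK hf

theorem mem [Finite I] (hK : IsSaturatedField L κ K) (hf : TypeDefinableFun L κ f) {H : Set K}
    (hH : IsTypeDefinable L κ ((↑) '' H : Set (Fin n → M))) :
    TypeDefinableRel L κ {v | f v ∈ H} :=
  (TypeDefinableRel.of_isTypeDefinable hK hH ()).comp hK fun _ : Unit => hf

theorem eq [Finite I] (hK : IsSaturatedField L κ K) (hf : TypeDefinableFun L κ f)
    (hg : TypeDefinableFun L κ g) : TypeDefinableRel L κ {v | f v = g v} := by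
  refine (TypeDefinableRel.apply_eq_apply hK (0 : Fin 2) 1).comp hK (f := ![f, g]) fun j => ?_
  fin_cases j
  exacts [hf, hg]

theorem range (hK : IsSaturatedField L κ K) {f : K → K}
    (hf : TypeDefinableFun L κ fun v : Unit → K => f (v ())) :
    IsTypeDefinable L κ ((↑) '' Set.range f : Set (Fin n → M)) := by
  refine TypeDefinableRel.isTypeDefinable ?_
  convert TypeDefinableRel.exists_of_finite (I := Unit) (J := Unit) hK
    ((hf.precomp hK Sum.inr).eq hK (typeDefinableFun_apply hK (Sum.inl ()))) using 1
  ext v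
  exact ⟨fun ⟨x, hx⟩ => ⟨fun _ => x, hx⟩, fun ⟨y, hy⟩ => ⟨y (), hy⟩⟩

theorem preimage (hK : IsSaturatedField L κ K) {f : K → K}
    (hf : TypeDefinableFun L κ fun v : Unit → K => f (v ())) {H : Set K}
    (hH : IsTypeDefinable L κ ((↑) '' H : Set (Fin n → M))) :
    IsTypeDefinable L κ ((↑) '' (f ⁻¹' H) : Set (Fin n → M)) :=
  TypeDefinableRel.isTypeDefinable (hf.mem hK hH)

end TypeDefinableFun

end Relations

/-! ### Translates of a subgroup of small index -/

section SmallIndex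

theorem mk_arrow_lt {κ : Cardinal.{w}} (hκ : κ.IsStrongLimit) {α β : Type w} (hα : #α < κ)
    (hβ : #β < κ) : #(α → β) < κ := by
  calc #(α → β) ≤ #(α → Set β) :=
        mk_le_of_injective (f := fun g a => {g a}) fun g g' h =>
          funext fun a => Set.singleton_injective (congrFun h a)
    _ = 2 ^ (#β * #α) := by simp [power_mul]
    _ < κ := hκ.isStrongPrelimit (mul_lt_of_lt hκ.aleph0_le hβ hα)

theorem mk_quotient_comap_le {A B : Type w} [AddCommGroup A] [AddCommGroup B] (f : A →+ B)
    (H : AddSubgroup B) : #(A ⧸ H.comap f) ≤ #(B ⧸ H) := by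
  refine mk_le_of_injective (f := QuotientAddGroup.map (H.comap f) H f le_rfl) ?_
  rw [injective_iff_map_eq_zero]
  intro x
  induction x using QuotientAddGroup.induction_on with
  | H a =>
    rw [QuotientAddGroup.map_mk, QuotientAddGroup.eq_zero_iff, QuotientAddGroup.eq_zero_iff]
    exact id

variable {K : Type w} [Field K] {κ : Cardinal.{w}} {H : AddSubgroup K}

/-- Since `κ` is a strong limit, there are fewer than `κ` maps `C → K ⧸ H`; two elements of `K`
inducing the same map have the required difference. -/
theorem exists_ne_zero_forall_inv_mul_mem (hκ : κ.IsStrongLimit) (hK : κ ≤ #K)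
    (hH : #(K ⧸ H) < κ) {C : Set K} (hC : #C < κ) : ∃ b ≠ 0, ∀ c ∈ C, c⁻¹ * b ∈ H := by
  have h := mk_arrow_lt hκ hC hH
  have : ¬ Function.Injective fun (b : K) (c : C) => ((c : K)⁻¹ * b : K ⧸ H) := fun hinj =>
    ((mk_le_of_injective hinj).trans_lt h).not_ge hK
  rw [Function.not_injective_iff] at this
  obtain ⟨b, b', h, hne⟩ := this
  refine ⟨b' - b, sub_ne_zero.2 hne.symm, fun c hc => ?_⟩
  have := QuotientAddGroup.eq.1 (congrFun h ⟨c, hc⟩)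
  rwa [mul_sub, sub_eq_neg_add]

theorem exists_family_forall_inv_mul_mem (hκ : κ.IsStrongLimit) (hK : κ ≤ #K)
    (hH : #(K ⧸ H) < κ) {C : Set K} (hC : #C < κ) {ι : Type w} [LinearOrder ι] [WellFoundedLT ι]
    (hι : #ι < κ) :
    ∃ b : ι → K, (∀ i, b i ≠ 0) ∧ (∀ i, ∀ c ∈ C, c⁻¹ * b i ∈ H) ∧
      ∀ i j, i < j → (b i)⁻¹ * b j ∈ H := by
  have h : ∀ D : Set K, ∃ b, #D < κ → b ≠ 0 ∧ ∀ c ∈ D, c⁻¹ * b ∈ H := fun D => by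
    by_cases hD : #D < κ
    · obtain ⟨b, hb, hb'⟩ := exists_ne_zero_forall_inv_mul_mem hκ hK hH hD
      exact ⟨b, fun _ => ⟨hb, hb'⟩⟩
    · exact ⟨0, fun h => absurd h hD⟩
  choose f hf using h
  let b : ι → K := (wellFounded_lt (α := ι)).fix fun i rec =>
    f (C ∪ Set.range fun j : Set.Iio i => rec j j.2)
  have hb : ∀ i, b i = f (C ∪ Set.range fun j : Set.Iio i => b j) := fun i =>
    (wellFounded_lt (α := ι)).fix_eq _ i
  have hb' : ∀ i, b i ≠ 0 ∧ ∀ c ∈ C ∪ Set.range (fun j : Set.Iio i => b j), c⁻¹ * b i ∈ H := by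
    intro i
    rw [hb i]
    exact hf _ ((mk_union_le _ _).trans_lt (add_lt_of_lt hκ.aleph0_le hC
      (mk_range_le.trans_lt ((mk_set_le _).trans_lt hι))))
  exact ⟨b, fun i => (hb' i).1, fun i c hc => (hb' i).2 c (Or.inl hc),
    fun i j hij => (hb' j).2 _ (Or.inr ⟨⟨i, hij⟩, rfl⟩)⟩

/-- The multiplicative translates of an additive subgroup `H` of small index are independent: there
are `c i` and `d i` with `d i ∈ c j • H` for `j ≠ i`, while `d i ∈ c i • (1 + H)`. -/
theorem exists_independent_translates (hκ : κ.IsStrongLimit) (hκ₀ : ℵ₀ < κ) (hK : κ ≤ #K)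
    (hH : #(K ⧸ H) < κ) (N : ℕ) {C : Set K} (hC : #C < κ) :
    ∃ c d : Fin N → K, (∀ i, c i ≠ 0) ∧ (∀ i, (c i)⁻¹ * d i - 1 ∈ H) ∧
      (∀ i j, i ≠ j → (c j)⁻¹ * d i ∈ H) ∧ ∀ i, ∀ x ∈ C, x⁻¹ * d i ∈ H := by
  induction N generalizing C with
  | zero => exact ⟨Fin.elim0, Fin.elim0, fun i => i.elim0, fun i => i.elim0, fun i => i.elim0,
      fun i => i.elim0⟩
  | succ N ih =>
    -- A power set, so that Cantor's theorem later forces two of the `b i` to agree modulo every `c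
    -- k • H`.
    let ι := Set (ULift.{w} (Fin N) → K ⧸ H)
    have hι : #ι < κ := by
      rw [mk_set]
      exact hκ.isStrongPrelimit (mk_arrow_lt hκ ((lt_aleph0_of_finite _).trans hκ₀) hH)
    obtain ⟨_, _⟩ := exists_wellFoundedLT ι
    obtain ⟨b, hb, hbC, hbb⟩ := exists_family_forall_inv_mul_mem hκ hK hH hC hι
    -- The whole family `b` goes into `C` beforehand, so the old `d k` lie in `b i • H` whichever
    -- `i` the collision selects.
    obtain ⟨c, d, hc, hcd, hcd', hdC⟩ := ih (C := C ∪ Set.range b)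
      ((mk_union_le _ _).trans_lt (add_lt_of_lt hκ.aleph0_le hC (mk_range_le.trans_lt hι)))
    have : ∃ i j : ι, (b i)⁻¹ * b j ∈ H ∧ ∀ k, (c k)⁻¹ * (b i - b j) ∈ H := by
      have := Function.cantor_injective fun (i : ι) (k : ULift.{w} (Fin N)) =>
        (((c k.down)⁻¹ * b i : K) : K ⧸ H)
      rw [Function.not_injective_iff] at this
      obtain ⟨i, j, h, hne⟩ := this
      have h' : ∀ k, -((c k)⁻¹ * b i) + (c k)⁻¹ * b j ∈ H := fun k =>
        QuotientAddGroup.eq.1 (congrFun h ⟨k⟩)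
      rcases lt_or_gt_of_ne hne with hij | hij
      · refine ⟨i, j, hbb i j hij, fun k => ?_⟩
        convert H.neg_mem (h' k) using 1
        ring
      · refine ⟨j, i, hbb j i hij, fun k => ?_⟩
        convert h' k using 1
        ring
    obtain ⟨i, j, hij, hk⟩ := this
    -- Here `(b i)⁻¹ * (b i - b j) = 1 - (b i)⁻¹ * b j` lies in `1 + H`.
    refine ⟨Fin.cons (b i) c, Fin.cons (b i - b j) d, ?_, ?_, ?_, ?_⟩
    · exact Fin.cases (hb i) hc
    · refine Fin.cases ?_ hcd
      simp only [Fin.cons_zero, mul_sub, inv_mul_cancel₀ (hb i)]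
      convert H.neg_mem hij using 1
      ring
    · refine Fin.cases (Fin.cases (fun h => absurd rfl h) fun k _ => ?_)
        fun k => Fin.cases (fun _ => ?_) fun l h => ?_
      · simpa using hk k
      · simpa using hdC k (b i) (Or.inr ⟨i, rfl⟩)
      · simpa using hcd' k l fun hkl => h (congrArg _ hkl)
    · refine Fin.cases (fun x hx => ?_) fun k x hx => ?_
      · rw [Fin.cons_zero, mul_sub]
        exact H.sub_mem (hbC i x hx) (hbC j x hx)
      · simpa using hdC k x (Or.inl hx)

end SmallIndex

/-! ### Connectedness of the additive group -/

section Connected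

variable {L : FirstOrder.Language.{u, v}} {T : L.Theory} {M : Type w} [L.Structure M]
  {κ : Cardinal.{w}} {n : ℕ} {K : Set (Fin n → M)} [Field K] [Infinite K]

theorem one_mem_of_mk_quotient_lt (hT : IsNIP T) (hM : M ⊨ T) (hκ : κ.IsStrongLimit)
    (hK : IsSaturatedField L κ K) {H : AddSubgroup K}
    (hH : IsTypeDefinable L κ ((↑) '' (H : Set K) : Set (Fin n → M))) (hidx : #(K ⧸ H) < κ) :
    (1 : K) ∈ H := by
  classical
  by_contra h1
  have hKκ : κ ≤ #K := SmallTypeDefinable.le_mk_of_infinite hK.isSaturated hK.aleph0_lt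
    hK.isTypeDefinableField.typeDefinable (Set.infinite_coe_iff.1 inferInstance)
  have : Nonempty M := by
    by_contra hM
    rw [not_nonempty_iff] at hM
    exact zero_ne_one (Subsingleton.elim (0 : K) 1)
  have inl : TypeDefinableFun L κ fun v : Fin 2 ⊕ Unit → K => v (Sum.inl 0) :=
    typeDefinableFun_apply hK _
  have inl' : TypeDefinableFun L κ fun v : Fin 2 ⊕ Unit → K => v (Sum.inl 1) :=
    typeDefinableFun_apply hK _
  have inr : TypeDefinableFun L κ fun v : Fin 2 ⊕ Unit → K => v (Sum.inr ()) :=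
    typeDefinableFun_apply hK _
  have one : TypeDefinableFun L κ fun _ : Fin 2 ⊕ Unit → K => 1 := typeDefinableFun_const hK 1
  have hP := (((inl.mul hK inr).eq hK one).inter hK
    ((inr.mul hK inl').mem hK hH)).exists_of_finite hK
  have hQ := (((inl.mul hK inr).eq hK one).inter hK
    (((inr.mul hK inl').sub hK one).mem hK hH)).exists_of_finite hK
  -- For `x ≠ 0`, the relations `x⁻¹ * y ∈ H` and `x⁻¹ * y ∈ 1 + H` exclude each other because `1 ∉
  -- H`; NIP is applied to the definable set `D` between them.
  obtain ⟨A, D, hD, hPD, hDQ⟩ := SmallTypeDefinable.exists_separating hK.isSaturated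
    hK.aleph0_lt hP hQ (by
      rw [Set.disjoint_image_iff coords_injective, Set.disjoint_left]
      rintro v ⟨y, hy, hyH⟩ ⟨z, hz, hzH⟩
      simp only [Set.mem_ofPred_eq, Sum.elim_inl, Sum.elim_inr, SetLike.mem_coe] at hy hyH hz hzH
      have hyz : y () = z () := mul_left_cancel₀ (left_ne_zero_of_mul_eq_one hy) (hy.trans hz.symm)
      rw [← hyz] at hzH
      exact h1 (by simpa using H.sub_mem hyH hzH))
  refine hT (hasIndependenceProperty_of_definable hM (hD.preimage_comp
    fun q : Fin 2 × Fin n => (![Sum.inl q.2, Sum.inr q.2] q.1 : Fin n ⊕ Fin n)) fun N => ?_)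
  obtain ⟨c, d, hc, hcd, hcd', -⟩ := exists_independent_translates hκ hK.aleph0_lt hKκ hidx N
    (C := ∅) (by simpa using aleph0_pos.trans hK.aleph0_lt)
  -- Modulo `H`, only the term `d i` contributes to `(c i)⁻¹ * e I`: the result is `0` if `i ∈ I`
  -- and `1` otherwise.
  let e : Set (Fin N) → K := fun I => ∑ i with i ∉ I, d i
  refine ⟨fun i => c i, fun I => e I, fun i I => ?_⟩
  have hco : (Sum.elim (c i : Fin n → M) (e I : Fin n → M)) ∘
      (fun q : Fin 2 × Fin n => (![Sum.inl q.2, Sum.inr q.2] q.1 : Fin n ⊕ Fin n)) =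
      coords ![c i, e I] := by
    ext ⟨j, k⟩
    fin_cases j <;> rfl
  rw [Set.mem_preimage, hco]
  constructor
  · intro h
    by_contra hi
    refine Set.disjoint_left.1 hDQ h ⟨![c i, e I], ⟨fun _ => (c i)⁻¹, mul_inv_cancel₀ (hc i), ?_⟩, rfl⟩
    change (c i)⁻¹ * e I - 1 ∈ H
    have : e I = d i + ∑ j ∈ (Finset.univ.filter (· ∉ I)).erase i, d j :=
      (Finset.add_sum_erase _ _ (by simpa using hi)).symm
    rw [this, mul_add, add_sub_right_comm, Finset.mul_sum]
    exact H.add_mem (hcd i) (H.sum_mem fun j hj => hcd' j i (Finset.ne_of_mem_erase hj))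
  · intro hi
    refine hPD ⟨![c i, e I], ⟨fun _ => (c i)⁻¹, mul_inv_cancel₀ (hc i), ?_⟩, rfl⟩
    change (c i)⁻¹ * e I ∈ H
    rw [Finset.mul_sum]
    refine H.sum_mem fun j hj => hcd' j i ?_
    rintro rfl
    exact (Finset.mem_filter.1 hj).2 hi

/-- The additive group of an infinite type-definable field in an NIP theory is connected. -/
theorem eq_top_of_mk_quotient_lt (hT : IsNIP T) (hM : M ⊨ T) (hκ : κ.IsStrongLimit)
    (hK : IsSaturatedField L κ K) {H : AddSubgroup K}
    (hH : IsTypeDefinable L κ ((↑) '' (H : Set K) : Set (Fin n → M))) (hidx : #(K ⧸ H) < κ) :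
    H = ⊤ := by
  refine H.eq_top_iff'.2 fun h => ?_
  have := one_mem_of_mk_quotient_lt hT hM hκ hK (H := H.comap (AddMonoidHom.mulLeft h))
    (TypeDefinableFun.preimage hK
      ((typeDefinableFun_const hK h).mul hK (typeDefinableFun_apply hK ())) hH)
    ((mk_quotient_comap_le _ H).trans_lt hidx)
  simpa using this

end Connected

/-! ### Producing chains of unbounded index -/

section Chains

variable {L : FirstOrder.Language.{u, v}} {T : L.Theory} {M : Type w} [L.Structure M]
  {κ : Cardinal.{w}} {n : ℕ} {K : Set (Fin n → M)} [Field K]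

theorem exists_isUnboundedChain {Q : AddSubgroup K → Prop}
    (hQ : ∀ G, Q G → IsTypeDefinable L κ ((↑) '' (G : Set K) : Set (Fin n → M)))
    {G₀ : AddSubgroup K} (h₀ : Q G₀)
    (hstep : ∀ G, Q G → ∃ G' ≤ G, Q G' ∧ HasUnboundedIndex κ G' G) :
    ∃ G : ℕ → AddSubgroup K, IsUnboundedChain L κ K G := by
  choose! next hle hnext hidx using hstep
  let G : ℕ → AddSubgroup K := fun i => next^[i] G₀
  have hG : ∀ i, G (i + 1) = next (G i) := fun i => Function.iterate_succ_apply' next i G₀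
  have hGQ : ∀ i, Q (G i) := fun i => by
    induction i with
    | zero => exact h₀
    | succ i ih => rw [hG]; exact hnext _ ih
  refine ⟨G, fun i => hQ _ (hGQ i), fun i => ?_⟩
  rw [hG]
  exact ⟨hle _ (hGQ i), hidx _ (hGQ i)⟩

/-- Pulling back along `f` does not increase the index, so bounded index of `H` in `G` would pass to
`f⁻¹(H)`, then to the larger `W`, contradicting connectedness. -/
theorem hasUnboundedIndex_of_map [Infinite K] (hT : IsNIP T) (hM : M ⊨ T)
    (hκ : κ.IsStrongLimit) (hK : IsSaturatedField L κ K) {G H W : AddSubgroup K} (f : K →+ K)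
    (hf : ∀ x, f x ∈ G) (hW : IsTypeDefinable L κ ((↑) '' (W : Set K) : Set (Fin n → M)))
    (hWtop : W ≠ ⊤) (h : ∀ x, f x ∈ H → x ∈ W) : HasUnboundedIndex κ H G := by
  by_contra hidx
  rw [HasUnboundedIndex, not_le] at hidx
  refine hWtop (eq_top_of_mk_quotient_lt hT hM hκ hK hW (lt_of_le_of_lt ?_
    ((mk_quotient_comap_le (f.codRestrict G hf) _).trans_lt hidx)))
  refine mk_le_of_surjective (f := QuotientAddGroup.map _ W (AddMonoidHom.id K) fun x hx => h x hx)
    fun x => ?_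
  induction x using QuotientAddGroup.induction_on with
  | H x => exact ⟨(x : K ⧸ _), rfl⟩

theorem typeDefinableFun_pow_sub (hK : IsSaturatedField L κ K) (p : ℕ) (a : K) :
    TypeDefinableFun L κ (fun v : Unit → K => a * (v () ^ p - v ())) :=
  (typeDefinableFun_const hK a).mul hK
    (((typeDefinableFun_apply hK ()).pow hK p).sub hK (typeDefinableFun_apply hK ()))

end Chains

/-! ### Additive polynomials modulo scaled Artin-Schreier images -/

section AdditivePolynomials

variable {K : Type*} [Field K] (p : ℕ) [Fact p.Prime] [CharP K p]

/-- The additive map `x ↦ a * (x ^ p - x)`. -/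
def scaledArtinSchreier (a : K) : K →+ K :=
  (AddMonoidHom.mulLeft a).comp ((frobenius K p).toAddMonoidHom - AddMonoidHom.id K)

@[simp]
theorem scaledArtinSchreier_apply (a x : K) : scaledArtinSchreier p a x = a * (x ^ p - x) := rfl

/-- The additive map `x ↦ ∑ i < m, e i * x ^ p ^ i`. -/
def additivePolynomial (e : ℕ → K) (m : ℕ) : K →+ K :=
  ∑ i ∈ Finset.range m, (AddMonoidHom.mulLeft (e i)).comp (iterateFrobenius K p i).toAddMonoidHom

@[simp]
theorem additivePolynomial_apply (e : ℕ → K) (m : ℕ) (x : K) :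
    additivePolynomial p e m x = ∑ i ∈ Finset.range m, e i * x ^ p ^ i := by
  simp [additivePolynomial, iterateFrobenius_def]

theorem mul_pow_sub_mem_range_scaledArtinSchreier (a z : K) (i : ℕ) :
    a * (z ^ p ^ i - z) ∈ (scaledArtinSchreier p a).range := by
  induction i with
  | zero => simp
  | succ i ih =>
    convert (scaledArtinSchreier p a).range.add_mem ⟨z ^ p ^ i, rfl⟩ ih using 1
    rw [scaledArtinSchreier_apply, pow_succ, pow_mul]
    ring

/-- Over an infinite perfect field, a nonzero additive polynomial is congruent to a nonzero linear
map modulo `a * (X ^ p - X)`, for a suitable `a`. -/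
theorem exists_sub_mem_range_scaledArtinSchreier [Infinite K]
    (hp : Function.Surjective (frobenius K p)) {e : ℕ → K} {m : ℕ} (he : e m ≠ 0) :
    ∃ a r : K, a ≠ 0 ∧ r ≠ 0 ∧
      ∀ x, additivePolynomial p e (m + 1) x - r * x ∈ (scaledArtinSchreier p a).range := by
  have hroot : ∀ i, ∃ y : K, y ^ p ^ i = e i := fun i => by
    obtain ⟨y, hy⟩ := (hp.iterate i) (e i)
    exact ⟨y, by rwa [← coe_iterateFrobenius, iterateFrobenius_def] at hy⟩
  choose ε hε using hroot
  have hp0 : 0 < p := (Fact.out : p.Prime).pos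
  have hp1 : 1 < p := (Fact.out : p.Prime).one_lt
  -- With `a = (t ^ p ^ m)⁻¹`, each `e i * x ^ p ^ i` equals `a * (ε i * t ^ p ^ (m - i) * x) ^ p ^
  -- i`, and the outer power may be dropped modulo `a • ℘(K)`. The sum becomes `a * q(t) * x`, so
  -- `t` must avoid the roots of `q`; the linear coefficient `ε m` shows `q ≠ 0`.
  let q : Polynomial K := ∑ i ∈ Finset.range (m + 1), Polynomial.monomial (p ^ (m - i)) (ε i)
  have hq : q ≠ 0 := by
    intro h
    have hcoeff : q.coeff 1 = ε m := by
      simp only [q, Polynomial.finsetSum_coeff, Polynomial.coeff_monomial]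
      rw [Finset.sum_eq_single_of_mem m (by simp) fun i hi him => if_neg ?_]
      · simp
      · have : i < m := lt_of_le_of_ne (Nat.lt_succ_iff.1 (Finset.mem_range.1 hi)) him
        exact (Nat.one_lt_pow (by omega) hp1).ne'
    rw [h, Polynomial.coeff_zero] at hcoeff
    refine he ?_
    rw [← hε m, ← hcoeff, zero_pow (pow_pos hp0 m).ne']
  obtain ⟨t, ht⟩ : ∃ t, q.eval t ≠ 0 := by
    by_contra! h
    exact hq (Polynomial.funext (by simpa using h))
  have hqt : q.eval t = ∑ i ∈ Finset.range (m + 1), ε i * t ^ p ^ (m - i) := by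
    simp [q, Polynomial.eval_finsetSum]
  have ht0 : t ≠ 0 := by
    rintro rfl
    refine ht (hqt.trans (Finset.sum_eq_zero fun i _ => ?_))
    rw [zero_pow (pow_pos hp0 _).ne', mul_zero]
  have hta : t ^ p ^ m ≠ 0 := pow_ne_zero _ ht0
  refine ⟨(t ^ p ^ m)⁻¹, (t ^ p ^ m)⁻¹ * q.eval t, inv_ne_zero hta,
    mul_ne_zero (inv_ne_zero hta) ht, fun x => ?_⟩
  rw [additivePolynomial_apply, hqt, Finset.mul_sum, Finset.sum_mul, ← Finset.sum_sub_distrib]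
  refine AddSubgroup.sum_mem _ fun i hi => ?_
  convert mul_pow_sub_mem_range_scaledArtinSchreier p (t ^ p ^ m)⁻¹ (ε i * t ^ p ^ (m - i) * x) i
    using 1
  have hi' : i ≤ m := Nat.lt_succ_iff.1 (Finset.mem_range.1 hi)
  rw [mul_pow, mul_pow, hε, ← pow_mul, ← pow_add, Nat.sub_add_cancel hi']
  field_simp

/-- Composing an additive polynomial with `b * (X ^ p - X)` raises its degree by a factor `p`. -/
theorem exists_additivePolynomial_comp {e : ℕ → K} {m : ℕ} (he : e m ≠ 0) {b : K} (hb : b ≠ 0) :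
    ∃ e' : ℕ → K, e' (m + 1) ≠ 0 ∧ ∀ z, additivePolynomial p e' (m + 1 + 1) z =
      additivePolynomial p e (m + 1) (b * (z ^ p - z)) := by
  let c : ℕ → K := fun i => e i * b ^ p ^ i
  -- `s` and `t` collect the two halves of `(z ^ p - z) ^ p ^ i = z ^ p ^ (i + 1) - z ^ p ^ i`; at
  -- degree `m + 1` only `s` survives.
  let s : ℕ → K := fun j => Nat.casesOn j 0 c
  let t : ℕ → K := fun j => if j ≤ m then c j else 0
  refine ⟨fun j => s j - t j, ?_, fun z => ?_⟩
  · simp [s, t, c, he, hb]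
  · rw [additivePolynomial_apply, additivePolynomial_apply]
    simp only [sub_mul, Finset.sum_sub_distrib]
    have hs : ∑ j ∈ Finset.range (m + 1 + 1), s j * z ^ p ^ j =
        ∑ i ∈ Finset.range (m + 1), c i * z ^ p ^ (i + 1) := by
      rw [Finset.sum_range_succ']
      simp [s]
    have ht : ∑ j ∈ Finset.range (m + 1 + 1), t j * z ^ p ^ j =
        ∑ i ∈ Finset.range (m + 1), c i * z ^ p ^ i := by
      rw [Finset.sum_range_succ]
      simp only [t, Nat.not_succ_le_self, if_false, zero_mul, add_zero]
      exact Finset.sum_congr rfl fun i hi => by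
        rw [if_pos (Nat.lt_succ_iff.1 (Finset.mem_range.1 hi))]
    rw [hs, ht, ← Finset.sum_sub_distrib]
    refine Finset.sum_congr rfl fun i _ => ?_
    have : (z ^ p - z) ^ p ^ i = z ^ p ^ (i + 1) - z ^ p ^ i := by
      rw [sub_pow_char_pow, ← pow_mul, pow_succ']
    rw [mul_pow, this]
    ring

end AdditivePolynomials

theorem isArtinSchreierClosed_of_forall_exists {K : Type w} [Field K] (p : ℕ) [Fact p.Prime]
    [CharP K p] (h : ∀ c : K, ∃ x, x ^ p - x = c) : IsArtinSchreierClosed p K := by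
  rintro E _ _ ⟨α, hα, ⟨c, hc⟩, -⟩
  obtain ⟨x, rfl⟩ := h c
  have : CharP E p := charP_of_injective_algebraMap (algebraMap K E).injective p
  have hfix : (α - algebraMap K E x) ^ p = α - algebraMap K E x := by
    rw [map_sub, map_pow] at hc
    rw [sub_pow_char]
    linear_combination -hc
  obtain ⟨y, hy⟩ : α - algebraMap K E x ∈ (algebraMap K E).fieldRange :=
    (bot_le : ⊥ ≤ (algebraMap K E).fieldRange) ((Subfield.mem_bot_iff_pow_eq_self E p).2 hfix)
  exact hα ⟨y + x, by rw [map_add, hy, sub_add_cancel]⟩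

/-! ### Perfectness and surjectivity of the Artin-Schreier map -/

section ArtinSchreier

variable {L : FirstOrder.Language.{u, v}} {T : L.Theory} {M : Type w} [L.Structure M]
  {κ : Cardinal.{w}} {n : ℕ} {K : Set (Fin n → M)} [Field K] [Infinite K]
  (p : ℕ) [Fact p.Prime] [CharP K p]

/-- By injectivity of Frobenius, each step of the chain `K ^ (p ^ i)` looks like `K ^ p` inside `K`.
-/
theorem frobenius_surjective_of_not_exists_chain (hT : IsNIP T) (hM : M ⊨ T)
    (hκ : κ.IsStrongLimit) (hK : IsSaturatedField L κ K)
    (hchain : ¬ ∃ G : ℕ → AddSubgroup K, IsUnboundedChain L κ K G) :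
    Function.Surjective (frobenius K p) := by
  by_contra hsurj
  have hTD : ∀ i, IsTypeDefinable L κ
      ((↑) '' ((iterateFrobenius K p i).toAddMonoidHom.range : Set K) : Set (Fin n → M)) :=
    fun i => TypeDefinableFun.range hK (f := fun x => iterateFrobenius K p i x)
      ((typeDefinableFun_apply hK ()).pow hK (p ^ i))
  refine hchain (exists_isUnboundedChain
    (Q := fun G => ∃ i, G = (iterateFrobenius K p i).toAddMonoidHom.range)
    (by rintro _ ⟨i, rfl⟩; exact hTD i) ⟨0, rfl⟩ ?_)
  rintro _ ⟨i, rfl⟩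
  refine ⟨_, ?_, ⟨i + 1, rfl⟩, hasUnboundedIndex_of_map hT hM hκ hK
    (iterateFrobenius K p i).toAddMonoidHom (fun x => ⟨x, rfl⟩) (hTD 1) ?_ ?_⟩
  · rintro _ ⟨x, rfl⟩
    exact ⟨x ^ p, by simp [iterateFrobenius_def, pow_succ', pow_mul]⟩
  · intro h
    refine hsurj fun x => ?_
    obtain ⟨y, hy⟩ := (AddSubgroup.eq_top_iff' _).1 h x
    exact ⟨y, by simpa using hy⟩
  · rintro x ⟨y, hy⟩
    refine ⟨y, (iterateFrobenius K p i).injective (Eq.trans ?_ hy)⟩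
    simp [iterateFrobenius_def, frobenius_def, pow_succ', pow_mul]

theorem exists_pow_sub_eq_of_not_exists_chain (hT : IsNIP T) (hM : M ⊨ T)
    (hκ : κ.IsStrongLimit) (hK : IsSaturatedField L κ K)
    (hchain : ¬ ∃ G : ℕ → AddSubgroup K, IsUnboundedChain L κ K G) (c : K) :
    ∃ x : K, x ^ p - x = c := by
  have hfrob := frobenius_surjective_of_not_exists_chain p hT hM hκ hK hchain
  by_contra hc
  have hTD : ∀ a, IsTypeDefinable L κ
      ((↑) '' ((scaledArtinSchreier p a).range : Set K) : Set (Fin n → M)) :=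
    fun a => TypeDefinableFun.range hK (typeDefinableFun_pow_sub hK p a)
  -- The invariant `Q` keeps a nonzero additive polynomial with values in `G`, starting from the
  -- identity on `⊤`; it stands in for finite intersections of the groups `a • ℘(K)`.
  refine hchain (exists_isUnboundedChain (G₀ := ⊤)
    (Q := fun G => IsTypeDefinable L κ ((↑) '' (G : Set K) : Set (Fin n → M)) ∧
      ∃ (m : ℕ) (e : ℕ → K), e m ≠ 0 ∧ ∀ x, additivePolynomial p e (m + 1) x ∈ G)
    (fun G hG => hG.1) ⟨?_, 0, 1, one_ne_zero, fun _ => trivial⟩ ?_)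
  · simpa using hK.isTypeDefinableField.typeDefinable
  rintro G ⟨hG, m, e, he, heG⟩
  obtain ⟨a, r, ha, hr, har⟩ := exists_sub_mem_range_scaledArtinSchreier p hfrob he
  have key : ∀ x, additivePolynomial p e (m + 1) x ∈ (scaledArtinSchreier p a).range ↔
      r * x ∈ (scaledArtinSchreier p a).range := fun x => by
    simpa using (AddSubgroup.add_mem_cancel_left _ (har x) (y := r * x))
  -- Substituting `x = r⁻¹ * a * (z ^ p - z)` makes `r * x` lie in `a • ℘(K)`, so by `key` the new
  -- polynomial takes values in the smaller group.
  obtain ⟨e', he', hee'⟩ := exists_additivePolynomial_comp p he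
    (mul_ne_zero (inv_ne_zero hr) ha)
  refine ⟨G ⊓ (scaledArtinSchreier p a).range, inf_le_left, ⟨?_, m + 1, e', he', fun z => ?_⟩,
    hasUnboundedIndex_of_map hT hM hκ hK (additivePolynomial p e (m + 1)) heG
      (W := (scaledArtinSchreier p a).range.comap (AddMonoidHom.mulLeft r)) ?_ ?_ ?_⟩
  · rw [AddSubgroup.coe_inf, Set.image_inter Subtype.val_injective]
    exact SmallTypeDefinable.inter hK.aleph0_lt hG (hTD a)
  · rw [hee']
    refine ⟨heG _, (key _).2 ⟨z, ?_⟩⟩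
    rw [scaledArtinSchreier_apply]
    field_simp
  · exact TypeDefinableFun.preimage hK
      ((typeDefinableFun_const hK r).mul hK (typeDefinableFun_apply hK ())) (hTD a)
  · intro h
    -- This element witnesses that `W` is proper: its multiple by `r` is `a * c`, and `c` is not in
    -- the image of `℘`.
    obtain ⟨x, hx⟩ := (AddSubgroup.eq_top_iff' _).1 h (r⁻¹ * (a * c))
    refine hc ⟨x, mul_left_cancel₀ ha ?_⟩
    simpa [hr] using hx
  · exact fun x hx => (key x).1 hx.2

end ArtinSchreier

end NIPField

theorem theorem4p8 {L : FirstOrder.Language.{u, v}} (T : L.Theory) (hT : NIPField.IsNIP T)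
    {M : Type w} [L.Structure M] (hM : M ⊨ T)
    (κ : Cardinal.{w}) (hκ : κ.IsStrongLimit) (hκ₀ : ℵ₀ < κ)
    (hκL : Cardinal.lift.{w} L.card < Cardinal.lift.{max u v} κ)
    (hsat : NIPField.IsSaturated L M κ)
    (p : ℕ) (hp : p.Prime) {n : ℕ} (K : Set (Fin n → M)) [Field K] [CharP K p] [Infinite K]
    (hK : NIPField.IsTypeDefinableField L κ K)
    (hchain : ¬ ∃ G : ℕ → AddSubgroup K, NIPField.IsUnboundedChain L κ K G) :
    NIPField.IsArtinSchreierClosed p K := by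
  have : Fact p.Prime := ⟨hp⟩
  exact NIPField.isArtinSchreierClosed_of_forall_exists p
    (NIPField.exists_pow_sub_eq_of_not_exists_chain p hT hM hκ ⟨hsat, hκ₀, hK⟩ hchain)
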